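/- Write $\mathcal L=\mathbb R\times\{0\}\subseteq\mathbb R^2$ and let $\|\cdot\|$ be the Euclidean norm. Definitions. Let $P^{(\varepsilon)}$ denote the closed $\varepsilon$-neighbourhood of $P$. A closed set $K\subseteq\mathbb R^d$ is *hyperplane diffuse* if there are $0<\beta<1$ and $\rho_K>0$ such that for all $0<\rho\le\rho_K$, $x\in K$ and all affine hyperplanes $P$ there is a point of $K$ in $B(x,\rho)\setminus P^{(\beta\rho)}$. A locally finite Borel measure $\mu$ on $\mathbb R^d$ is *$\delta$-Ahlfors regular* if there are $c_1,c_2,\rho_0>0$ with $c_1\rho^\delta\le\mu(B(x,\rho))\le c_2\rho^\delta$ for all $x\in\operatorname{supp}\mu$, $0<\rho<\rho_0$. A map $f$ on $U\subseteq\mathbb R^d$ is *$L$-bi-Lipschitz* if $L^{-1}\|x-y\|\le\|f(x)-f(y)\|\le L\|x-y\|$ for all $x,y\in U$. A set $S\subseteq\mathbb R^d$ is *incompressible on $K\subseteq\mathbb R^d$* if for every open $U$ with $U\cap K\ne\varnothing$, every $L\ge1$ and every sequence of $L$-bi-Lipschitz maps $f_i:U\to\mathbb R^d$, the set $K\cap\bigcap_i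 f_i^{-1}(S)$ has the same Hausdorff dimension as $K\cap U$. A set $S\subseteq\mathbb R^d$ is *hyperplane absolute winning (HAW)* if there is $\beta_0>0$ such that for all $0<\beta<\min(\beta_0,1/3)$ Alice has a winning strategy in the following game: Bob chooses a closed ball $B_1\subseteq\mathbb R^d$ of positive radius; when $B_i$, of radius $\rho_i$, has been chosen, Alice chooses an affine hyperplane $P_i$ and a number $0<\varepsilon_i\le\beta\rho_i$, and Bob then chooses a closed ball $B_{i+1}\subseteq B_i$ of radius $\rho_{i+1}\ge\beta\rho_i$ disjoint from $P_i^{(\varepsilon_i)}$; Alice wins if $S\cap\bigcap_iB_i\neq\varnothing$ (or if Bob has no legal move). Finally, identifying $2\times1$ matrices with vectors in $\mathbb R^2$, let $$\mathrm{Bad}_{\mathbf 0}(2,1)=\Bigl\{v\in\mathbb R^2:\ \inf_{q\in\mathbb Z\setminus\{0\}}|q|^{1/2}\operatorname{dist}(qv,\mathbb Z^2)>0\Bigr\}.$$ Theorem. Let $K\subseteq\mathbb R^2$ be the limit set of the three similarities $$u_0(x,y)=\Bigl(\frac x5,\frac y5\Bigr),\quad u_1(x,y)=\Bigl(\frac{2+x}5,\frac{4+y}5\Bigr),\quad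 u_2(x,y)=\Bigl(\frac{4+x}5,\frac y5\Bigr),$$ i.e. the nonempty compact set with $K=u_0(K)\cup u_1(K)\cup u_2(K)$. Then $K$ is hyperplane diffuse, $K$ is the support of a $\delta$-Ahlfors regular measure for some $\delta>0$, and there is a $6$-bi-Lipschitz map $\Phi:\mathbb R^2\to\mathbb R^2$ with $K\subseteq\Phi(\mathcal L)$ such that: 1. $\mathbb R^2\setminus\mathcal L$ is not incompressible on $K$; 2. $\mathrm{Bad}_{\mathbf 0}(2,1)\subseteq\mathbb R^2\setminus\mathcal L$, and $\mathrm{Bad}_{\mathbf 0}(2,1)$ is not incompressible on $K$; 3. $\mathbb R^2\setminus\mathcal L$ is HAW but $\Phi(\mathbb R^2\setminus\mathcal L)$ is not HAW; thus the HAW property is not preserved by bi-Lipschitz maps of $\mathbb R^2$. -/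

import Mathlib

open Set MeasureTheory

noncomputable section

namespace HyperplaneGame

/-- Euclidean space `ℝ^d`. -/
abbrev E (d : ℕ) : Type := EuclideanSpace ℝ (Fin d)

/-! ### Affine planes and diffuse sets -/

/-- `P` is a (nonempty) `k`-dimensional affine subspace of `ℝ^d`. -/
def IsAffinePlane {d : ℕ} (k : ℕ) (P : AffineSubspace ℝ (E d)) : Prop :=
  (P : Set (E d)).Nonempty ∧ Module.finrank ℝ P.direction = k

/-- `K` is `k`-dimensionally `β`-diffuse. -/
def IsDiffuseWith {d : ℕ} (k : ℕ) (β : ℝ) (K : Set (E d)) : Prop :=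
  IsClosed K ∧ ∃ ρK : ℝ, 0 < ρK ∧ ∀ ρ : ℝ, 0 < ρ → ρ ≤ ρK → ∀ x ∈ K,
    ∀ P : AffineSubspace ℝ (E d), IsAffinePlane k P →
      ∃ x' ∈ K, x' ∈ Metric.closedBall x ρ \ Metric.cthickening (β * ρ) (P : Set (E d))

/-- `K` is hyperplane diffuse: `(d-1)`-dimensionally `β`-diffuse for some `0 < β < 1`. -/
def IsHyperplaneDiffuse {d : ℕ} (K : Set (E d)) : Prop :=
  ∃ β : ℝ, 0 < β ∧ β < 1 ∧ IsDiffuseWith (d - 1) β K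

/-! ### Ahlfors regular measures -/

/-- A locally finite Borel measure on `ℝ^d` is `δ`-Ahlfors regular. -/
def IsAhlforsRegular {d : ℕ} (δ : ℝ) (μ : Measure (E d)) : Prop :=
  IsLocallyFiniteMeasure μ ∧
    ∃ c₁ c₂ ρ₀ : ℝ, 0 < c₁ ∧ 0 < c₂ ∧ 0 < ρ₀ ∧
      ∀ x ∈ μ.support, ∀ ρ : ℝ, 0 < ρ → ρ < ρ₀ →
        ENNReal.ofReal (c₁ * ρ ^ δ) ≤ μ (Metric.closedBall x ρ) ∧
          μ (Metric.closedBall x ρ) ≤ ENNReal.ofReal (c₂ * ρ ^ δ)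

/-! ### Bi-Lipschitz maps and incompressibility -/

/-- `f` is `L`-bi-Lipschitz on `U`. -/
def IsBiLipschitzOn {d : ℕ} (L : ℝ) (f : E d → E d) (U : Set (E d)) : Prop :=
  ∀ x ∈ U, ∀ y ∈ U, L⁻¹ * ‖x - y‖ ≤ ‖f x - f y‖ ∧ ‖f x - f y‖ ≤ L * ‖x - y‖

/-- `S` is incompressible on `K`. The maps `f i` matter only through their restrictions to `U`. -/
def IsIncompressibleOn {d : ℕ} (S K : Set (E d)) : Prop :=
  ∀ U : Set (E d), IsOpen U → (U ∩ K).Nonempty → ∀ L : ℝ, 1 ≤ L →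
    ∀ f : ℕ → E d → E d, (∀ i, IsBiLipschitzOn L (f i) U) →
      dimH (K ∩ ⋂ i, (U ∩ f i ⁻¹' S)) = dimH (K ∩ U)

/-! ### The hyperplane absolute game -/

/-- A closed ball of positive radius in `ℝ^d`, given by its center and radius. -/
structure Ball (d : ℕ) where
  center : E d
  radius : ℝ
  radius_pos : 0 < radius

/-- The set of points of a closed ball. -/
def Ball.carrier {d : ℕ} (B : Ball d) : Set (E d) := Metric.closedBall B.center B.radius

/-- A move of Alice: an affine subspace together with the width of the neighborhood removed. -/
structure AliceMove (d : ℕ) where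
  plane : AffineSubspace ℝ (E d)
  width : ℝ

/-- Legality of Alice's move `A` answering Bob's ball `B`. -/
def AliceMove.IsLegal {d : ℕ} (k : ℕ) (β : ℝ) (B : Ball d) (A : AliceMove d) : Prop :=
  IsAffinePlane k A.plane ∧ 0 < A.width ∧ A.width ≤ β * B.radius

/-- Legality of Bob's ball `B'` when his previous ball was `B` and Alice answered with `A`. -/
def Ball.IsLegal {d : ℕ} (β : ℝ) (B : Ball d) (A : AliceMove d) (B' : Ball d) : Prop :=
  B'.carrier ⊆ B.carrier ∧ β * B.radius ≤ B'.radius ∧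
    Disjoint B'.carrier (Metric.cthickening A.width (A.plane : Set (E d)))

/-- `S` is `k`-dimensionally `β`-absolute winning: Alice has a strategy `σ` (a function of Bob's
previous balls `B 0, …, B (n-1)` and his current ball `B n`) which prescribes legal moves, such that
for every infinite sequence of legal moves of Bob against `σ` the intersection of his balls
meets `S`. -/
def IsAbsoluteWinningWith {d : ℕ} (k : ℕ) (β : ℝ) (S : Set (E d)) : Prop :=
  ∃ σ : List (Ball d) → Ball d → AliceMove d,
    (∀ (h : List (Ball d)) (B : Ball d), (σ h B).IsLegal k β B) ∧
    ∀ B : ℕ → Ball d,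
      (∀ n : ℕ, (B n).IsLegal β (σ ((List.range n).map B) (B n)) (B (n + 1))) →
        (S ∩ ⋂ n, (B n).carrier).Nonempty

/-- `S ⊆ ℝ^d` is hyperplane absolute winning. -/
def IsHAW {d : ℕ} (S : Set (E d)) : Prop :=
  ∃ β₀ : ℝ, 0 < β₀ ∧ ∀ β : ℝ, 0 < β → β < β₀ → β < 1 / 3 → IsAbsoluteWinningWith (d - 1) β S

/-! ### Badly approximable systems of affine forms -/

/-- The real vector with integer coordinates `q`, with its Euclidean norm. -/
def intVec {n : ℕ} (q : Fin n → ℤ) : E n := WithLp.toLp 2 (fun j => (q j : ℝ))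

/-- The set of pairs `(A, x)` such that the system of affine forms `q ↦ A q - x` is badly
approximable. -/
def Bad (M N : ℕ) : Set (Matrix (Fin M) (Fin N) ℝ × E M) :=
  {p | 0 < ⨅ q : {q : Fin N → ℤ // q ≠ 0},
    ‖intVec q.1‖ ^ ((N : ℝ) / (M : ℝ)) *
      Metric.infDist (WithLp.toLp 2 (p.1.mulVec (fun j => (q.1 j : ℝ))) - p.2)
        (Set.range (intVec : (Fin M → ℤ) → E M))}

/-- The slice of `Bad M N` at `x ∈ ℝ^M`. -/
def BadSlice (M N : ℕ) (x : E M) : Set (Matrix (Fin M) (Fin N) ℝ) := {A | (A, x) ∈ Bad M N}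

/-- A set of `M × 1` matrices as a subset of `ℝ^M`. -/
def columns {M : ℕ} (S : Set (Matrix (Fin M) (Fin 1) ℝ)) : Set (E M) :=
  {v | Matrix.of (fun i _ => v i) ∈ S}

/-! ### The objects of the example -/

/-- The `x`-axis in the plane. -/
def xAxis : Set (E 2) := {p | p 1 = 0}

/-- `K` is the limit set of the (finite) family `u` of contractions: the nonempty compact set
with `K = ⋃ i, u i (K)`. -/
def IsLimitSet {d : ℕ} {ι : Type} (u : ι → E d → E d) (K : Set (E d)) : Prop :=
  K.Nonempty ∧ IsCompact K ∧ K = ⋃ i, u i '' K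

/-- Three similarities of the plane of ratio `1/5`. -/
def threeMaps : Fin 3 → E 2 → E 2 :=
  ![fun p => !₂[p 0 / 5, p 1 / 5],
    fun p => !₂[(2 + p 0) / 5, (4 + p 1) / 5],
    fun p => !₂[(4 + p 0) / 5, p 1 / 5]]

end HyperplaneGame

end

noncomputable section

namespace HyperplaneGame

open Filter Topology
open scoped ENNReal NNReal RealInnerProductSpace

/-! ### The game -/

/-! The limit set is a Lipschitz graph. In base 5 its points have first-coordinate digits 0, 2, 4,
so addresses that first differ at place `k` give first coordinates at least `5^{-(k+1)}` apart,
while the second coordinates differ by at most `5^{-k}` (`abs_yCode_sub_le`). Extending the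
resulting 5-Lipschitz function to `g` on the line, the shear by `g` is bi-Lipschitz with inverse the
shear by `-g`, and it carries the axis onto a curve containing the limit set.

The inverse shear thus sends the limit set into the axis. Used as a constant sequence, it makes the
intersection in the definition of incompressibility empty, although the limit set has positive
dimension by Ahlfors regularity. Dirichlet's theorem puts `Bad` off the axis, so the same argument
applies to it.

In the game, Bob can keep his centers in a closed diffuse set, so no set disjoint from it is HAW
(`not_isHAW_of_isHyperplaneDiffuse`). Diffuseness holds because the fixed points of the three
similarities are not collinear and small copies of this triangle occur near every point. -/

theorem Ball.isLegal_of_notMem_cthickening {d : ℕ} {β ε : ℝ} (hβ : 0 < β) (hβ2 : β ≤ 1 / 2)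
    (hβε : 4 * β ≤ ε) {B B' : Ball d} {A : AliceMove d} {k : ℕ} (hA : A.IsLegal k β B)
    (hr : B'.radius = β * B.radius)
    (hc : B'.center ∈ Metric.closedBall B.center (B.radius / 2))
    (hP : B'.center ∉ Metric.cthickening (ε * (B.radius / 2)) (A.plane : Set (E d))) :
    B.IsLegal β A B' := by
  have hB := B.radius_pos
  refine ⟨Metric.closedBall_subset_closedBall' ?_, hr.ge,
    Set.disjoint_left.2 fun y hy hyA => hP ?_⟩
  · rw [Metric.mem_closedBall] at hc
    rw [hr]
    nlinarith
  · obtain ⟨-, hw, hwβ⟩ := hA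
    have hβr : 0 ≤ β * B.radius := by positivity
    -- A common point would put the new center within `2 * β * B.radius` of the plane, which is at
    -- most `ε * (B.radius / 2)`.
    have h1 : B'.center ∈ Metric.cthickening (β * B.radius)
        (Metric.cthickening A.width (A.plane : Set (E d))) := by
      refine Metric.mem_cthickening_of_dist_le _ y _ _ hyA ?_
      rw [Ball.carrier, Metric.mem_closedBall, hr, dist_comm] at hy
      exact hy
    have h2 := Metric.cthickening_cthickening_subset hβr hw.le _ h1
    refine Metric.cthickening_mono ?_ _ h2
    nlinarith

/-- Diffuseness at half of Bob's current radius supplies his next center in `K`, away from Alice's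
plane. The radii shrink geometrically, so the centers converge to the only possible outcome, which
lies in `K` since `K` is closed. -/
theorem not_isHAW_of_isHyperplaneDiffuse {d : ℕ} {K S : Set (E d)} (hK : IsHyperplaneDiffuse K)
    (hne : K.Nonempty) (hKS : Disjoint K S) : ¬ IsHAW S := by
  rintro ⟨β₀, hβ₀, hwin⟩
  obtain ⟨ε, hε, hε1, hKc, R, hR, hdiff⟩ := hK
  set β : ℝ := min (β₀ / 2) (ε / 4) with hβdef
  have hβ : 0 < β := by positivity
  have hβε : β ≤ ε / 4 := min_le_right _ _
  have hββ₀ : β ≤ β₀ / 2 := min_le_left _ _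
  obtain ⟨σ, hσ, hσwin⟩ := hwin β hβ (by linarith) (by linarith)
  let G := {B : Ball d // B.center ∈ K ∧ B.radius ≤ R}
  have step : ∀ (l : List (Ball d)) (b : G), ∃ b' : G,
      b'.1.radius = β * b.1.radius ∧ b.1.IsLegal β (σ l b.1) b'.1 := by
    rintro l ⟨b, hbK, hbR⟩
    have hb := b.radius_pos
    have hl := hσ l b
    obtain ⟨x', hx'K, hx'b, hx'P⟩ := hdiff (b.radius / 2) (by linarith) (by linarith) _ hbK
      (σ l b).plane hl.1
    refine ⟨⟨⟨x', β * b.radius, by positivity⟩, hx'K, ?_⟩, rfl, ?_⟩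
    · change β * b.radius ≤ R
      nlinarith
    · exact Ball.isLegal_of_notMem_cthickening hβ (by linarith) (by linarith) hl rfl hx'b hx'P
  choose next hnext_r hnext using step
  obtain ⟨x₀, hx₀⟩ := hne
  -- The history is carried along with the current ball because Alice's strategy may depend on all
  -- of it.
  let st : ℕ → List (Ball d) × G := fun n =>
    Nat.rec ([], ⟨⟨x₀, R, hR⟩, hx₀, le_rfl⟩) (fun _ p => (p.1 ++ [p.2.1], next p.1 p.2)) n
  let B : ℕ → Ball d := fun n => (st n).2.1
  have hst : ∀ n, (st n).1 = (List.range n).map B := by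
    intro n
    induction n with
    | zero => rfl
    | succ n ih =>
      rw [List.range_succ, List.map_append, ← ih]
      rfl
  have hBK : ∀ n, (B n).center ∈ K := fun n => (st n).2.2.1
  have hBr : ∀ n, (B n).radius = β ^ n * R := by
    intro n
    induction n with
    | zero => change R = _; simp
    | succ n ih =>
      have : (B (n + 1)).radius = β * (B n).radius := hnext_r _ _
      rw [this, ih]
      ring
  obtain ⟨p, hpS, hp⟩ := hσwin B fun n => by
    rw [← hst]
    exact hnext _ _
  refine Set.disjoint_left.1 hKS (hKc.mem_of_tendsto (b := atTop) (f := fun n => (B n).center)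
    ?_ (Eventually.of_forall hBK)) hpS
  rw [tendsto_iff_dist_tendsto_zero]
  refine squeeze_zero (fun _ => dist_nonneg) (g := fun n => β ^ n * R) (fun n => ?_) ?_
  · have := mem_iInter.1 hp n
    rwa [Ball.carrier, Metric.mem_closedBall, hBr, dist_comm] at this
  · simpa using (tendsto_pow_atTop_nhds_zero_of_lt_one hβ.le (by linarith)).mul_const R

/-- Alice always names `P`, so Bob's second ball already misses it; compactness supplies a point in
all the balls. -/
theorem isHAW_compl_of_isAffinePlane {d : ℕ} {P : AffineSubspace ℝ (E d)}
    (hP : IsAffinePlane (d - 1) P) : IsHAW (P : Set (E d))ᶜ := by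
  refine ⟨1, one_pos, fun β hβ _ _ => ⟨fun _ B => ⟨P, β * B.radius⟩, fun _ B =>
    ⟨hP, mul_pos hβ B.radius_pos, le_rfl⟩, fun B hB => ?_⟩⟩
  obtain ⟨p, hp⟩ := IsCompact.nonempty_iInter_of_sequence_nonempty_isCompact_isClosed
    (fun n => (B n).carrier) (fun n => (hB n).1)
    (fun n => Metric.nonempty_closedBall.2 (B n).radius_pos.le)
    (isCompact_closedBall _ _) (fun n => Metric.isClosed_closedBall)
  exact ⟨p, fun hpP => Set.disjoint_left.1 (hB 0).2.2 (mem_iInter.1 hp 1)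
    (Metric.self_subset_cthickening _ hpP), hp⟩

theorem isHAW_compl_xAxis : IsHAW xAxisᶜ := by
  have hx : xAxis = ((Submodule.span ℝ {(EuclideanSpace.single 0 1 : E 2)}).toAffineSubspace :
      Set (E 2)) := by
    ext p
    simp only [xAxis, Set.mem_ofPred_eq, SetLike.mem_coe, Submodule.mem_toAffineSubspace,
      Submodule.mem_span_singleton]
    constructor
    · intro h
      refine ⟨p 0, ?_⟩
      ext i
      fin_cases i <;> simp [h]
    · rintro ⟨a, rfl⟩
      simp
  rw [hx]
  refine isHAW_compl_of_isAffinePlane ⟨⟨0, ?_⟩, ?_⟩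
  · simp
  · rw [Submodule.toAffineSubspace_direction, finrank_span_singleton]
    simp

/-! ### Ahlfors regular measures have supports of positive dimension -/

/-- Mass distribution principle: the upper regularity bound dominates `μ` by a multiple of
`δ`-dimensional Hausdorff measure, and `μ` charges its support. -/
theorem dimH_support_pos_of_isAhlforsRegular {d : ℕ} {δ : ℝ} {μ : Measure (E d)} (hδ : 0 < δ)
    (hμ : IsAhlforsRegular δ μ) (hne : μ.support.Nonempty) : 0 < dimH μ.support := by
  obtain ⟨-, c₁, c₂, ρ₀, hc₁, hc₂, hρ₀, h⟩ := hμ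
  set C : ℝ≥0∞ := ENNReal.ofReal c₂
  have hC : C ≠ 0 := by simpa [C] using hc₂
  have hCt : C ≠ ∞ := ENNReal.ofReal_ne_top
  have key : ∀ s : Set (E d), Metric.ediam s ≤ ENNReal.ofReal (ρ₀ / 2) →
      (C⁻¹ • μ) s ≤ Metric.ediam s ^ δ := by
    intro s hs
    rw [Measure.smul_apply, smul_eq_mul, ENNReal.inv_mul_le_iff hC hCt]
    rcases (s ∩ μ.support).eq_empty_or_nonempty with hemp | ⟨x, hxs, hx⟩
    · have : μ s ≤ μ μ.supportᶜ :=
        measure_mono fun y hy hy' => (hemp ▸ (⟨hy, hy'⟩ : y ∈ s ∩ μ.support) : y ∈ (∅ : Set (E d)))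
      rw [Measure.measure_compl_support] at this
      exact this.trans zero_le
    · have hst : Metric.ediam s ≠ ∞ := ne_top_of_le_ne_top ENNReal.ofReal_ne_top hs
      have hD : Metric.ediam s = ENNReal.ofReal (Metric.diam s) := (ENNReal.ofReal_toReal hst).symm
      have hdiam : Metric.diam s ≤ ρ₀ / 2 := ENNReal.toReal_le_of_le_ofReal (by positivity) hs
      -- The diameter may be zero while the ball estimate needs a positive radius, so radii
      -- decreasing to the diameter are used.
      have hb : ∀ᶠ r in 𝓝[>] (Metric.diam s), μ s ≤ C * ENNReal.ofReal r ^ δ := by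
        filter_upwards [Ioo_mem_nhdsGT (show Metric.diam s < ρ₀ by linarith)] with r hr
        have hr0 : 0 < r := Metric.diam_nonneg.trans_lt hr.1
        have h2 := (h x hx r hr0 hr.2).2
        rw [ENNReal.ofReal_mul hc₂.le, ← ENNReal.ofReal_rpow_of_pos hr0] at h2
        refine (measure_mono fun y hy => ?_).trans h2
        exact (Metric.dist_le_diam_of_mem (Metric.isBounded_iff_ediam_ne_top.2 hst) hy hxs).trans
          hr.1.le
      rw [hD]
      refine ge_of_tendsto (tendsto_nhdsWithin_of_tendsto_nhds ?_) hb
      have : Continuous fun r : ℝ => C * ENNReal.ofReal r ^ δ :=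
        (ENNReal.continuous_const_mul hCt).comp
          (ENNReal.continuous_rpow_const.comp ENNReal.continuous_ofReal)
      exact this.tendsto _
  have hle := Measure.le_hausdorffMeasure δ (C⁻¹ • μ) _ (by simpa using hρ₀) key
  have hpos : μ μ.support ≠ 0 := by
    intro h0
    obtain ⟨x, hx⟩ := hne
    have h1 := (h x hx (ρ₀ / 2) (by positivity) (by linarith)).1
    have h2 : μ (Metric.closedBall x (ρ₀ / 2)) ≤ μ (μ.support ∪ μ.supportᶜ) :=
      measure_mono (by simp)
    have h3 := h1.trans (h2.trans (measure_union_le _ _))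
    rw [h0, Measure.measure_compl_support, add_zero, nonpos_iff_eq_zero,
      ENNReal.ofReal_eq_zero] at h3
    exact absurd h3 (not_le.2 (by positivity))
  have hH : Measure.hausdorffMeasure ((δ.toNNReal : ℝ≥0) : ℝ) μ.support ≠ 0 := by
    rw [Real.coe_toNNReal _ hδ.le]
    intro h0
    have := hle μ.support
    rw [h0, Measure.smul_apply, smul_eq_mul, nonpos_iff_eq_zero, mul_eq_zero] at this
    exact this.elim (ENNReal.inv_ne_zero.2 hCt) hpos
  refine lt_of_lt_of_le ?_ (le_dimH_of_hausdorffMeasure_ne_zero hH)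
  simpa using hδ

/-! ### Badly approximable vectors avoid the axis -/

/-- On the axis only one coordinate needs approximating. Dirichlet's exponent 1 there beats the
exponent 1/2: the infimum is at most `√n / (n + 1)` for every `n`. -/
theorem columns_badSlice_subset_compl_xAxis : columns (BadSlice 2 1 0) ⊆ xAxisᶜ := by
  intro v hv hv1
  change v 1 = 0 at hv1
  set F : {q : Fin 1 → ℤ // q ≠ 0} → ℝ := fun q => ‖intVec q.1‖ ^ (((1 : ℕ) : ℝ) / ((2 : ℕ) : ℝ)) *
      Metric.infDist (WithLp.toLp 2 ((Matrix.of fun i _ => v i : Matrix (Fin 2) (Fin 1) ℝ).mulVec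
        (fun j => (q.1 j : ℝ))) - 0) (Set.range (intVec : (Fin 2 → ℤ) → E 2)) with hF
  have hbdd : BddBelow (Set.range F) :=
    ⟨0, by rintro _ ⟨q, rfl⟩; exact mul_nonneg (by positivity) Metric.infDist_nonneg⟩
  have hv : 0 < iInf F := hv
  obtain ⟨n, hn⟩ := exists_nat_gt (1 / (iInf F) ^ 2)
  have hn0 : 0 < n := by
    have : (0 : ℝ) < n := lt_trans (by positivity) hn
    exact_mod_cast this
  obtain ⟨j, k, hk0, hkn, hjk⟩ := Real.exists_int_int_abs_mul_sub_le (v 0) hn0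
  have hFk := ciInf_le hbdd ⟨fun _ => k, fun h => hk0.ne' (congrFun h 0)⟩
  have hdist : Metric.infDist (WithLp.toLp 2
      ((Matrix.of fun i _ => v i : Matrix (Fin 2) (Fin 1) ℝ).mulVec (fun _ => (k : ℝ))) - 0)
      (Set.range (intVec : (Fin 2 → ℤ) → E 2)) ≤ 1 / (n + 1) := by
    refine (Metric.infDist_le_dist_of_mem (Set.mem_range_self ![j, 0])).trans (le_trans (le_of_eq ?_) hjk)
    rw [EuclideanSpace.dist_eq, Fin.sum_univ_two]
    simp [intVec, Matrix.mulVec, dotProduct, hv1, Real.dist_eq, mul_comm, Real.sqrt_sq_eq_abs]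
  have hnorm : ‖(intVec (fun _ => k) : E 1)‖ = k := by
    have : (0 : ℝ) < k := by exact_mod_cast hk0
    simp [intVec, EuclideanSpace.norm_eq, Real.sqrt_sq this.le]
  have hkn' : (k : ℝ) ≤ n := by exact_mod_cast hkn
  have hb : iInf F ≤ √n * (1 / (n + 1)) := by
    refine hFk.trans ?_
    simp only [hF, hnorm]
    rw [show ((1 : ℕ) : ℝ) / ((2 : ℕ) : ℝ) = 1 / 2 by norm_num, ← Real.sqrt_eq_rpow]
    exact mul_le_mul (Real.sqrt_le_sqrt hkn') hdist Metric.infDist_nonneg (Real.sqrt_nonneg _)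
  have hnpos : (0 : ℝ) < n := by exact_mod_cast hn0
  have hsq : (iInf F) ^ 2 ≤ (√n * (1 / (n + 1))) ^ 2 := by gcongr
  rw [mul_pow, Real.sq_sqrt hnpos.le] at hsq
  have h3 : (n : ℝ) * (1 / (n + 1)) ^ 2 ≤ 1 / n := by
    rw [div_pow, one_pow, mul_one_div, div_le_div_iff₀ (by positivity) hnpos]
    nlinarith
  rw [div_lt_iff₀ (by positivity)] at hn
  have h4 := (le_div_iff₀ hnpos).1 (hsq.trans h3)
  nlinarith

/-! ### Symbolic coding of the limit set -/

/-- The base-`5` digit of the first coordinate. -/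
def xDigit : Fin 3 → Fin 5 := ![0, 2, 4]

/-- The base-`5` digit of the second coordinate. -/
def yDigit : Fin 3 → Fin 5 := ![0, 4, 0]

/-- The first coordinate of the point with a given address. -/
def xCode (ω : ℕ → Fin 3) : ℝ := Real.ofDigits fun n => xDigit (ω n)

/-- The second coordinate of the point with a given address. -/
def yCode (ω : ℕ → Fin 3) : ℝ := Real.ofDigits fun n => yDigit (ω n)

/-- The point with a given address. -/
def codePoint (ω : ℕ → Fin 3) : E 2 := !₂[xCode ω, yCode ω]

/-- The limit set. -/
def limitSet : Set (E 2) := Set.range codePoint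

theorem continuous_codePoint : Continuous codePoint := by
  have hx : Continuous xCode :=
    Real.continuous_ofDigits.comp (by fun_prop)
  have hy : Continuous yCode :=
    Real.continuous_ofDigits.comp (by fun_prop)
  refine (PiLp.continuous_toLp 2 _).comp (continuous_pi fun i => ?_)
  fin_cases i
  · exact hx
  · exact hy

theorem ofDigits_cons (f : Fin 3 → Fin 5) (ω : ℕ → Fin 3) :
    Real.ofDigits (fun n => f (ω n)) =
      (((f (ω 0) : ℕ) : ℝ) + Real.ofDigits (fun n => f (ω (n + 1)))) / 5 := by
  rw [Real.ofDigits_eq_sum_add_ofDigits _ 1]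
  simp [Real.ofDigitsTerm]
  ring

theorem codePoint_eq_threeMaps (ω : ℕ → Fin 3) :
    codePoint ω = threeMaps (ω 0) (codePoint fun n => ω (n + 1)) := by
  have hx := ofDigits_cons xDigit ω
  have hy := ofDigits_cons yDigit ω
  generalize hi : ω 0 = i at *
  ext j
  fin_cases i <;> fin_cases j <;>
    simp_all [codePoint, xCode, yCode, threeMaps, xDigit, yDigit]

theorem isLimitSet_limitSet : IsLimitSet threeMaps limitSet := by
  refine ⟨Set.range_nonempty _, isCompact_range continuous_codePoint, ?_⟩
  ext p
  simp only [limitSet, Set.mem_range, Set.mem_iUnion, Set.mem_image]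
  constructor
  · rintro ⟨ω, rfl⟩
    exact ⟨ω 0, _, ⟨_, rfl⟩, (codePoint_eq_threeMaps ω).symm⟩
  · rintro ⟨i, _, ⟨ω, rfl⟩, rfl⟩
    exact ⟨fun n => Nat.casesOn n i ω, codePoint_eq_threeMaps _⟩

/-- Distinct values of `xDigit` differ by at least 2, and the tails can cancel at most 1 of this. -/
theorem inv_pow_le_abs_xCode_sub {ω η : ℕ → Fin 3} {k : ℕ} (h : ∀ i < k, ω i = η i)
    (hk : ω k ≠ η k) : ((5 : ℝ) ^ (k + 1))⁻¹ ≤ |xCode ω - xCode η| := by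
  have hω := Real.ofDigits_eq_sum_add_ofDigits (fun n => xDigit (ω n)) (k + 1)
  have hη := Real.ofDigits_eq_sum_add_ofDigits (fun n => xDigit (η n)) (k + 1)
  rw [Finset.sum_range_succ] at hω hη
  have hs : ∑ i ∈ Finset.range k, Real.ofDigitsTerm (fun n => xDigit (ω n)) i =
      ∑ i ∈ Finset.range k, Real.ofDigitsTerm (fun n => xDigit (η n)) i :=
    Finset.sum_congr rfl fun i hi => by simp [Real.ofDigitsTerm, h i (Finset.mem_range.1 hi)]
  have b1 := Real.ofDigits_nonneg fun n => xDigit (ω (n + (k + 1)))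
  have b2 := Real.ofDigits_le_one fun n => xDigit (ω (n + (k + 1)))
  have b3 := Real.ofDigits_nonneg fun n => xDigit (η (n + (k + 1)))
  have b4 := Real.ofDigits_le_one fun n => xDigit (η (n + (k + 1)))
  set r := Real.ofDigits fun n => xDigit (ω (n + (k + 1)))
  set r' := Real.ofDigits fun n => xDigit (η (n + (k + 1)))
  have hdiff : xCode ω - xCode η = (((xDigit (ω k) : ℕ) : ℝ) - ((xDigit (η k) : ℕ) : ℝ) + (r - r'))
      * ((5 : ℝ) ^ (k + 1))⁻¹ := by
    rw [xCode, xCode, hω, hη, hs]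
    simp only [Real.ofDigitsTerm]
    push_cast
    ring
  rw [hdiff, abs_mul, abs_of_pos (a := ((5 : ℝ) ^ (k + 1))⁻¹) (by positivity)]
  refine le_mul_of_one_le_left (by positivity) ?_
  rw [le_abs]
  generalize ω k = a at *
  generalize η k = b at *
  fin_cases a <;> fin_cases b <;> simp_all [xDigit] <;> first | (left; linarith) | (right; linarith)

theorem exists_first_ne {ω η : ℕ → Fin 3} (h : ω ≠ η) :
    ∃ k, (∀ i < k, ω i = η i) ∧ ω k ≠ η k := by
  classical
  have h' : ∃ k, ω k ≠ η k := Function.ne_iff.1 h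
  exact ⟨Nat.find h', fun i hi => not_not.1 (Nat.find_min h' hi), Nat.find_spec h'⟩

theorem abs_yCode_sub_le (ω η : ℕ → Fin 3) :
    |yCode ω - yCode η| ≤ 5 * |xCode ω - xCode η| := by
  rcases eq_or_ne ω η with rfl | hne
  · simp
  obtain ⟨k, hk, hk'⟩ := exists_first_ne hne
  have h1 := inv_pow_le_abs_xCode_sub hk hk'
  have h2 : |yCode ω - yCode η| ≤ ((5 : ℝ) ^ k)⁻¹ := by
    have := Real.abs_ofDigits_sub_ofDigits_le (x := fun n => yDigit (ω n))
      (y := fun n => yDigit (η n)) (n := k) fun i hi => by rw [hk i hi]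
    simpa using! this
  rw [pow_succ, mul_inv] at h1
  linarith

/-! ### Cylinders -/

/-- The addresses which agree with `ω` in the first `n` places. -/
def cyl (ω : ℕ → Fin 3) (n : ℕ) : Set (ℕ → Fin 3) := {η | ∀ i < n, η i = ω i}

theorem norm_le_two_mul {p : E 2} {s : ℝ} (h0 : |p 0| ≤ s) (h1 : |p 1| ≤ s) : ‖p‖ ≤ 2 * s := by
  have hs : 0 ≤ s := (abs_nonneg _).trans h0
  rw [EuclideanSpace.norm_eq, Fin.sum_univ_two]
  refine Real.sqrt_le_iff.2 ⟨by positivity, ?_⟩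
  simp only [Real.norm_eq_abs]
  have := abs_nonneg (p 0)
  have := abs_nonneg (p 1)
  nlinarith

theorem dist_codePoint_le {ω η : ℕ → Fin 3} {n : ℕ} (h : η ∈ cyl ω n) :
    dist (codePoint η) (codePoint ω) ≤ 2 * ((5 : ℝ) ^ n)⁻¹ := by
  rw [dist_eq_norm]
  have hx := Real.abs_ofDigits_sub_ofDigits_le (x := fun n => xDigit (η n))
      (y := fun n => xDigit (ω n)) (n := n) fun i hi => by rw [h i hi]
  have hy := Real.abs_ofDigits_sub_ofDigits_le (x := fun n => yDigit (η n))
      (y := fun n => yDigit (ω n)) (n := n) fun i hi => by rw [h i hi]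
  exact norm_le_two_mul (by simpa [codePoint] using! hx) (by simpa [codePoint] using! hy)

/-- Together with `dist_codePoint_le` this makes cylinders comparable to balls; the first coordinate
alone detects the prefix. -/
theorem mem_cyl_of_dist_lt {ω η : ℕ → Fin 3} {n : ℕ}
    (h : dist (codePoint η) (codePoint ω) < ((5 : ℝ) ^ n)⁻¹) : η ∈ cyl ω n := by
  by_contra hc
  obtain ⟨k, hk, hk'⟩ := exists_first_ne (ω := η) (η := ω) fun he => hc fun i _ => by rw [he]
  have hkn : k < n := by
    by_contra hkn
    exact hc fun i hi => hk i (by omega)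
  have h1 := inv_pow_le_abs_xCode_sub hk hk'
  have h2 : |xCode η - xCode ω| ≤ dist (codePoint η) (codePoint ω) := by
    rw [dist_eq_norm]
    simpa [codePoint] using! PiLp.norm_apply_le (codePoint η - codePoint ω) 0
  have h3 : ((5 : ℝ) ^ n)⁻¹ ≤ ((5 : ℝ) ^ (k + 1))⁻¹ := by
    gcongr
    · norm_num
    · exact hkn
  linarith

theorem exists_scale {t : ℝ} (ht : 0 < t) (ht1 : t ≤ 1) :
    ∃ n : ℕ, ((5 : ℝ) ^ (n + 1))⁻¹ < t ∧ t ≤ ((5 : ℝ) ^ n)⁻¹ := by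
  simpa [inv_pow] using exists_nat_pow_near_of_lt_one ht ht1
    (show (0 : ℝ) < 5⁻¹ by norm_num) (by norm_num)

/-! ### Diffuseness -/

/-- Pairing with a normal vector `a` is constant on `P`, so only the two displacements to `P`
contribute. -/
theorem abs_inner_sub_le_of_mem_cthickening {d : ℕ} {P : AffineSubspace ℝ (E d)} {a x y : E d}
    {ε : ℝ} (hε : 0 ≤ ε) (ha : a ∈ P.directionᗮ) (hx : x ∈ Metric.cthickening ε (P : Set (E d)))
    (hy : y ∈ Metric.cthickening ε (P : Set (E d))) : |⟪a, x - y⟫| ≤ ‖a‖ * (2 * ε) := by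
  have hc : IsClosed (P : Set (E d)) := P.closed_of_finiteDimensional
  rw [hc.cthickening_eq_biUnion_closedBall hε] at hx hy
  simp only [Set.mem_iUnion, Metric.mem_closedBall, dist_eq_norm, exists_prop] at hx hy
  obtain ⟨p, hp, hxp⟩ := hx
  obtain ⟨q, hq, hyq⟩ := hy
  have hpq : ⟪a, p - q⟫ = 0 := by
    rw [real_inner_comm]
    exact ha _ (AffineSubspace.vsub_mem_direction hp hq)
  have : x - y = (x - p) - (y - q) + (p - q) := by abel
  rw [this, inner_add_right, hpq, add_zero]
  refine (abs_real_inner_le_norm _ _).trans ?_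
  gcongr
  exact (norm_sub_le _ _).trans (by linarith)

theorem exists_ne_zero_mem_orthogonal {P : AffineSubspace ℝ (E 2)} (hP : IsAffinePlane 1 P) :
    ∃ a ∈ P.directionᗮ, a ≠ 0 := by
  refine Submodule.exists_mem_ne_zero_of_ne_bot fun h => ?_
  have := P.direction.finrank_add_finrank_orthogonal
  rw [h, hP.2] at this
  simp at this

/-- The address which follows `ω` for `m` places and is constant from then on. -/
def tailConst (ω : ℕ → Fin 3) (m : ℕ) (c : Fin 3) : ℕ → Fin 3 := fun n => if n < m then ω n else c

theorem tailConst_mem_cyl (ω : ℕ → Fin 3) (m : ℕ) (c : Fin 3) : tailConst ω m c ∈ cyl ω m :=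
  fun i hi => by simp [tailConst, hi]

theorem ofDigits_tailConst_sub (f : Fin 3 → Fin 5) (ω : ℕ → Fin 3) (m : ℕ) (c c' : Fin 3) :
    Real.ofDigits (fun n => f (tailConst ω m c n)) - Real.ofDigits (fun n => f (tailConst ω m c' n))
      = ((5 : ℝ) ^ m)⁻¹ * ((((f c : ℕ) : ℝ) - ((f c' : ℕ) : ℝ)) / 4) := by
  have hconst : ∀ c : Fin 3, Real.ofDigits (fun _ : ℕ => f c) = ((f c : ℕ) : ℝ) / 4 := by
    intro c
    have := ofDigits_cons f fun _ => c
    linarith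
  have htail : ∀ c : Fin 3, Real.ofDigits (fun n => f (tailConst ω m c n)) =
      ∑ i ∈ Finset.range m, Real.ofDigitsTerm (fun n => f (ω n)) i +
        ((5 : ℝ) ^ m)⁻¹ * (((f c : ℕ) : ℝ) / 4) := by
    intro c
    rw [Real.ofDigits_eq_sum_add_ofDigits _ m, ← hconst]
    congr 1
    · refine Finset.sum_congr rfl fun i hi => ?_
      simp [Real.ofDigitsTerm, tailConst, Finset.mem_range.1 hi]
    · simp [tailConst]
  rw [htail, htail]
  ring

/-- The ball contains a copy, scaled by `s`, of the triangle of fixed points `(0, 0)`, `(1/2, 1)`,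
`(1, 0)`. If all three vertices were near a line, its normal would be almost orthogonal to two
independent edges. -/
theorem isHyperplaneDiffuse_limitSet : IsHyperplaneDiffuse limitSet := by
  refine ⟨1 / 100, by norm_num, by norm_num, (isCompact_range continuous_codePoint).isClosed, 1,
    one_pos, ?_⟩
  rintro ρ hρ hρ1 _ ⟨ω, rfl⟩ P hP
  obtain ⟨a, ha, ha0⟩ := exists_ne_zero_mem_orthogonal hP
  obtain ⟨n, hn1, hn2⟩ := exists_scale (t := ρ / 2) (by positivity) (by linarith)
  set s : ℝ := ((5 : ℝ) ^ (n + 1))⁻¹ with hs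
  have hs0 : 0 < s := by positivity
  have hρs : ρ ≤ 10 * s := by
    rw [hs, pow_succ, mul_inv]
    linarith
  by_contra! hcon
  have hmem : ∀ c, codePoint (tailConst ω (n + 1) c) ∈
      Metric.cthickening (1 / 100 * ρ) (P : Set (E 2)) := by
    intro c
    by_contra hc
    refine hcon _ ⟨_, rfl⟩ ⟨?_, hc⟩
    rw [Metric.mem_closedBall]
    exact (dist_codePoint_le (tailConst_mem_cyl ω _ c)).trans (by linarith)
  have hin : ∀ c c', ⟪a, codePoint (tailConst ω (n + 1) c) - codePoint (tailConst ω (n + 1) c')⟫ =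
      a 0 * (s * ((((xDigit c : ℕ) : ℝ) - ((xDigit c' : ℕ) : ℝ)) / 4)) +
      a 1 * (s * ((((yDigit c : ℕ) : ℝ) - ((yDigit c' : ℕ) : ℝ)) / 4)) := by
    intro c c'
    rw [← ofDigits_tailConst_sub xDigit ω, ← ofDigits_tailConst_sub yDigit ω]
    simp [PiLp.inner_apply, Fin.sum_univ_two, codePoint, xCode, yCode, mul_comm]
  have hA : 0 < ‖a‖ := norm_pos_iff.2 ha0
  -- Since `ρ ≤ 10 * s`, the constant 1/100 leaves error `‖a‖ / 5` per edge; then `|a 0|` and `|a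
  -- 1|` are at most `0.2 * ‖a‖` and `0.3 * ‖a‖`, too small for the norm of `a`.
  have hbound : ‖a‖ * (2 * (1 / 100 * ρ)) ≤ s * (‖a‖ / 5) := by nlinarith
  have h20 := (abs_inner_sub_le_of_mem_cthickening (by positivity) ha (hmem 2) (hmem 0)).trans hbound
  have h10 := (abs_inner_sub_le_of_mem_cthickening (by positivity) ha (hmem 1) (hmem 0)).trans hbound
  rw [hin] at h20 h10
  have e20 : |a 0| ≤ ‖a‖ / 5 := by
    refine le_of_mul_le_mul_left (le_trans (le_of_eq ?_) h20) hs0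
    rw [← abs_of_pos hs0, ← abs_mul, abs_of_pos hs0]
    congr 1
    simp [xDigit, yDigit]
    ring
  have e10 : |a 0 / 2 + a 1| ≤ ‖a‖ / 5 := by
    refine le_of_mul_le_mul_left (le_trans (le_of_eq ?_) h10) hs0
    rw [← abs_of_pos hs0, ← abs_mul, abs_of_pos hs0]
    congr 1
    simp [xDigit, yDigit]
    ring
  have hnorm : ‖a‖ ^ 2 = a 0 ^ 2 + a 1 ^ 2 := by
    rw [EuclideanSpace.norm_sq_eq, Fin.sum_univ_two]
    simp
  have e1 : |a 1| ≤ 3 / 10 * ‖a‖ := by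
    rw [abs_le] at *
    constructor <;> linarith
  have q0 := sq_le_sq.2 (e20.trans (le_abs_self _))
  have q1 := sq_le_sq.2 (e1.trans (le_abs_self _))
  nlinarith

/-! ### The self-similar measure -/

/-- The image under the coding of the uniform Bernoulli measure. -/
def limitMeasure : Measure (E 2) :=
  (Measure.infinitePi fun _ : ℕ => ProbabilityTheory.uniformOn (Set.univ : Set (Fin 3))).map codePoint

theorem infinitePi_cyl (ω : ℕ → Fin 3) (n : ℕ) :
    (Measure.infinitePi fun _ : ℕ => ProbabilityTheory.uniformOn (Set.univ : Set (Fin 3)))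
      (cyl ω n) = ENNReal.ofReal (((3 : ℝ) ^ n)⁻¹) := by
  have : cyl ω n = Set.pi (Finset.range n : Set ℕ) fun i => {ω i} := by
    ext η
    simp [cyl]
  rw [this, Measure.infinitePi_pi _ fun i _ => measurableSet_singleton _]
  simp [ProbabilityTheory.uniformOn_univ, ENNReal.ofReal_inv_of_pos, ENNReal.ofReal_pow,
    ENNReal.inv_pow]

theorem limitMeasure_closedBall (x : E 2) (ρ : ℝ) : limitMeasure (Metric.closedBall x ρ) =
    (Measure.infinitePi fun _ : ℕ => ProbabilityTheory.uniformOn (Set.univ : Set (Fin 3)))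
      (codePoint ⁻¹' Metric.closedBall x ρ) :=
  Measure.map_apply continuous_codePoint.measurable Metric.isClosed_closedBall.measurableSet

/-- The similarity dimension of the limit set. -/
def simDim : ℝ := Real.logb 5 3

theorem simDim_pos : 0 < simDim := Real.logb_pos (by norm_num) (by norm_num)

/-- This converts the scale of a level-`n` cylinder into its mass. -/
theorem inv_five_pow_rpow_simDim (n : ℕ) : (((5 : ℝ) ^ n)⁻¹) ^ simDim = ((3 : ℝ) ^ n)⁻¹ := by
  rw [Real.inv_rpow (by positivity), ← Real.rpow_natCast, ← Real.rpow_mul (by norm_num), mul_comm,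
    Real.rpow_mul (by norm_num), simDim, Real.rpow_logb (by norm_num) (by norm_num) (by norm_num),
    Real.rpow_natCast]

theorem le_limitMeasure_closedBall (ω : ℕ → Fin 3) {ρ : ℝ} (hρ : 0 < ρ) (hρ1 : ρ < 1 / 2) :
    ENNReal.ofReal ((1 / 10) ^ simDim * ρ ^ simDim) ≤
      limitMeasure (Metric.closedBall (codePoint ω) ρ) := by
  obtain ⟨n, hn1, hn2⟩ := exists_scale (t := ρ / 2) (by positivity) (by linarith)
  rw [limitMeasure_closedBall]
  refine le_trans ?_ (measure_mono (s := cyl ω (n + 1)) fun η hη => ?_)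
  · rw [infinitePi_cyl, ← inv_five_pow_rpow_simDim, ← Real.mul_rpow (by norm_num) hρ.le]
    refine ENNReal.ofReal_le_ofReal (Real.rpow_le_rpow (by positivity) ?_ simDim_pos.le)
    rw [pow_succ, mul_inv]
    linarith
  · exact (dist_codePoint_le hη).trans (by linarith)

theorem limitMeasure_closedBall_le (ω : ℕ → Fin 3) {ρ : ℝ} (hρ : 0 < ρ) (hρ1 : ρ < 1 / 2) :
    limitMeasure (Metric.closedBall (codePoint ω) ρ) ≤
      ENNReal.ofReal (10 ^ simDim * ρ ^ simDim) := by
  -- Doubling `ρ` gives the strict inequality `ρ < 5^{-n}` needed for a closed ball, and still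
  -- `5^{-n} < 10 * ρ`.
  obtain ⟨n, hn1, hn2⟩ := exists_scale (t := 2 * ρ) (by positivity) (by linarith)
  rw [limitMeasure_closedBall]
  refine le_trans (measure_mono (t := cyl ω n) fun η hη => ?_) ?_
  · refine mem_cyl_of_dist_lt (lt_of_le_of_lt hη ?_)
    linarith
  · rw [infinitePi_cyl, ← inv_five_pow_rpow_simDim, ← Real.mul_rpow (by norm_num) hρ.le]
    refine ENNReal.ofReal_le_ofReal (Real.rpow_le_rpow (by positivity) ?_ simDim_pos.le)
    rw [pow_succ, mul_inv] at hn1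
    linarith

theorem support_limitMeasure : limitMeasure.support = limitSet := by
  refine Subset.antisymm (Measure.support_subset_of_isClosed
    (isCompact_range continuous_codePoint).isClosed ?_) ?_
  · refine (ae_map_iff continuous_codePoint.aemeasurable
      (isCompact_range continuous_codePoint).isClosed.measurableSet).2 (.of_forall fun ω => ⟨ω, rfl⟩)
  · rintro _ ⟨ω, rfl⟩
    rw [Metric.nhds_basis_closedBall.mem_measureSupport]
    intro r hr
    have hm : 0 < min r (1 / 3) := by positivity
    refine lt_of_lt_of_le ?_ ((le_limitMeasure_closedBall ω hm
      ((min_le_right _ _).trans_lt (by norm_num))).trans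
        (measure_mono (Metric.closedBall_subset_closedBall (min_le_left _ _))))
    rw [ENNReal.ofReal_pos]
    positivity

theorem isAhlforsRegular_limitMeasure : IsAhlforsRegular simDim limitMeasure := by
  have : IsProbabilityMeasure limitMeasure :=
    Measure.isProbabilityMeasure_map continuous_codePoint.aemeasurable
  refine ⟨inferInstance, (1 / 10) ^ simDim, 10 ^ simDim, 1 / 2, by positivity, by positivity,
    by norm_num, ?_⟩
  rw [support_limitMeasure]
  rintro _ ⟨ω, rfl⟩ ρ hρ hρ1
  exact ⟨le_limitMeasure_closedBall ω hρ hρ1, limitMeasure_closedBall_le ω hρ hρ1⟩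

/-! ### The shear -/

/-- The vertical shear by `g`. -/
def shear (g : ℝ → ℝ) (p : E 2) : E 2 := !₂[p 0, p 1 + g (p 0)]

theorem shear_neg_shear (g : ℝ → ℝ) (p : E 2) : shear (-g) (shear g p) = p := by
  ext i
  fin_cases i <;> simp [shear]

theorem norm_shear_sub_le {g : ℝ → ℝ} (hg : LipschitzWith 5 g) (p q : E 2) :
    ‖shear g p - shear g q‖ ≤ 6 * ‖p - q‖ := by
  have h := hg.dist_le_mul (p 0) (q 0)
  rw [Real.dist_eq, Real.dist_eq] at h
  rw [EuclideanSpace.norm_eq, EuclideanSpace.norm_eq, Fin.sum_univ_two, Fin.sum_univ_two]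
  refine Real.sqrt_le_iff.2 ⟨by positivity, ?_⟩
  rw [mul_pow, Real.sq_sqrt (by positivity)]
  simp only [shear, PiLp.sub_apply, Real.norm_eq_abs, sq_abs]
  simp only [Matrix.cons_val_zero, Matrix.cons_val_one]
  push_cast at h
  set u := p 0 - q 0
  set w := p 1 - q 1
  have e : p 1 + g (p 0) - (q 1 + g (q 0)) = w + (g (p 0) - g (q 0)) := by ring
  rw [e]
  set z := g (p 0) - g (q 0)
  have hz : z ^ 2 ≤ 25 * u ^ 2 := by
    rw [← sq_abs z, ← sq_abs u]
    nlinarith [abs_nonneg z, abs_nonneg u]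
  -- The first square gives `(w + z)^2 ≤ 6 * w^2 + (6/5) * z^2 ≤ 6 * w^2 + 30 * u^2`.
  nlinarith [sq_nonneg (5 * w - z), sq_nonneg u, sq_nonneg w]

theorem isBiLipschitzOn_shear {g : ℝ → ℝ} (hg : LipschitzWith 5 g) (U : Set (E 2)) :
    IsBiLipschitzOn 6 (shear g) U := by
  refine fun p _ q _ => ⟨?_, norm_shear_sub_le hg p q⟩
  have := norm_shear_sub_le hg.neg (shear g p) (shear g q)
  rw [shear_neg_shear, shear_neg_shear] at this
  linarith

/-- Since `xCode` is injective, `yCode` is a function of it, 5-Lipschitz on the range, and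
real-valued Lipschitz functions extend with the same constant. -/
theorem exists_lipschitz_graph : ∃ g : ℝ → ℝ, LipschitzWith 5 g ∧ ∀ ω, g (xCode ω) = yCode ω := by
  have hinj : Function.Injective xCode := by
    intro ω η h
    by_contra hne
    obtain ⟨k, hk, hk'⟩ := exists_first_ne hne
    have := inv_pow_le_abs_xCode_sub hk hk'
    rw [h, sub_self, abs_zero] at this
    exact absurd this (not_le.2 (by positivity))
  have hL : LipschitzOnWith 5 (Function.extend xCode yCode 0) (Set.range xCode) := by
    refine LipschitzOnWith.of_dist_le_mul ?_
    rintro _ ⟨ω, rfl⟩ _ ⟨η, rfl⟩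
    rw [hinj.extend_apply, hinj.extend_apply, Real.dist_eq, Real.dist_eq]
    exact_mod_cast abs_yCode_sub_le ω η
  obtain ⟨g, hg, hgeq⟩ := hL.extend_real
  exact ⟨g, hg, fun ω => by rw [← hgeq ⟨ω, rfl⟩, hinj.extend_apply]⟩

end HyperplaneGame

end

/-! ### Straightening the limit set onto the axis -/

theorem mainTheorem7 :
    ∃ (K : Set (HyperplaneGame.E 2)) (Φ : HyperplaneGame.E 2 → HyperplaneGame.E 2),
      HyperplaneGame.IsLimitSet HyperplaneGame.threeMaps K ∧
      HyperplaneGame.IsHyperplaneDiffuse K ∧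
      (∃ (μ : MeasureTheory.Measure (HyperplaneGame.E 2)) (δ : ℝ),
        0 < δ ∧ HyperplaneGame.IsAhlforsRegular δ μ ∧ μ.support = K) ∧
      HyperplaneGame.IsBiLipschitzOn 6 Φ Set.univ ∧
      K ⊆ Φ '' HyperplaneGame.xAxis ∧
      ¬ HyperplaneGame.IsIncompressibleOn HyperplaneGame.xAxisᶜ K ∧
      HyperplaneGame.columns (HyperplaneGame.BadSlice 2 1 0) ⊆ HyperplaneGame.xAxisᶜ ∧
      ¬ HyperplaneGame.IsIncompressibleOn
        (HyperplaneGame.columns (HyperplaneGame.BadSlice 2 1 0)) K ∧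
      HyperplaneGame.IsHAW HyperplaneGame.xAxisᶜ ∧
      ¬ HyperplaneGame.IsHAW (Φ '' HyperplaneGame.xAxisᶜ) := by
  obtain ⟨g, hg, hgc⟩ := HyperplaneGame.exists_lipschitz_graph
  have hsub : HyperplaneGame.limitSet ⊆
      HyperplaneGame.shear g '' HyperplaneGame.xAxis := by
    rintro _ ⟨ω, rfl⟩
    refine ⟨!₂[HyperplaneGame.xCode ω, 0], by simp [HyperplaneGame.xAxis], ?_⟩
    simp [HyperplaneGame.shear, HyperplaneGame.codePoint, hgc]
  have hne : HyperplaneGame.limitSet.Nonempty := Set.range_nonempty _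
  have hdim : 0 < dimH HyperplaneGame.limitSet := by
    rw [← HyperplaneGame.support_limitMeasure] at hne ⊢
    exact HyperplaneGame.dimH_support_pos_of_isAhlforsRegular HyperplaneGame.simDim_pos
      HyperplaneGame.isAhlforsRegular_limitMeasure hne
  -- The single map `shear (-g)`, repeated, sends every point of the limit set into the axis and
  -- hence outside `S`.
  have hcomp : ∀ S ⊆ HyperplaneGame.xAxisᶜ,
      ¬ HyperplaneGame.IsIncompressibleOn S HyperplaneGame.limitSet := by
    intro S hS hinc
    have h := hinc Set.univ isOpen_univ (by simpa using hne) 6 (by norm_num)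
      (fun _ => HyperplaneGame.shear (-g))
      fun _ => HyperplaneGame.isBiLipschitzOn_shear hg.neg _
    have hempty : HyperplaneGame.limitSet ∩
        ⋂ _ : ℕ, (Set.univ ∩ HyperplaneGame.shear (-g) ⁻¹' S) = ∅ := by
      refine Set.eq_empty_of_forall_notMem ?_
      rintro p ⟨hpK, hp⟩
      obtain ⟨q, hq, rfl⟩ := hsub hpK
      have hqS := (Set.mem_iInter.1 hp 0).2
      rw [Set.mem_preimage, HyperplaneGame.shear_neg_shear] at hqS
      exact hS hqS hq
    rw [hempty, dimH_empty, Set.inter_univ] at h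
    exact hdim.ne h
  refine ⟨HyperplaneGame.limitSet, HyperplaneGame.shear g, HyperplaneGame.isLimitSet_limitSet,
    HyperplaneGame.isHyperplaneDiffuse_limitSet,
    ⟨HyperplaneGame.limitMeasure, HyperplaneGame.simDim, HyperplaneGame.simDim_pos,
      HyperplaneGame.isAhlforsRegular_limitMeasure, HyperplaneGame.support_limitMeasure⟩,
    HyperplaneGame.isBiLipschitzOn_shear hg _, hsub, hcomp _ subset_rfl,
    HyperplaneGame.columns_badSlice_subset_compl_xAxis,
    hcomp _ HyperplaneGame.columns_badSlice_subset_compl_xAxis,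
    HyperplaneGame.isHAW_compl_xAxis,
    HyperplaneGame.not_isHAW_of_isHyperplaneDiffuse HyperplaneGame.isHyperplaneDiffuse_limitSet
      hne (Set.disjoint_left.2 fun p hpK hp => ?_)⟩
  obtain ⟨q, hq, rfl⟩ := hsub hpK
  obtain ⟨q', hq', he⟩ := hp
  refine hq' ?_
  rwa [Function.LeftInverse.injective (HyperplaneGame.shear_neg_shear g) he]
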